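/- Let $\mathbb K$ be a field, $n\ge 2$, $\mathbf a=(a_1,\dots,a_n)$ a vector of integers with all $a_i\ge 3$, and $\mathbf q=(q_{ij})$ an $n\times n$ matrix over $\mathbb K$ with $q_{ii}=1$ and $q_{ij}q_{ji}=1$ for all $i,j$, and $q_{ij}\ne 1$ for all $i\ne j$. Let $$A=A(\mathbf q,\mathbf a)=\mathbb K\langle x_1,\dots,x_n\rangle/\langle x_i^{a_i},\ x_jx_i-q_{ij}x_ix_j,\ 1\le i,j\le n\rangle$$ be the quantum complete intersection, with standard basis $x_{\mathbf v}=x_1^{v_1}\cdots x_n^{v_n}$, $\mathbf v\in V=\{\mathbf v\in\mathbb N_0^n : v_i\le a_i-1 \text{ for all } i\}$, graded by $|x_{\mathbf v}|=\sum_i v_i$. A bi-Frobenius algebra structure on a finite-dimensional $\mathbb K$-algebra $A$ consists of a coalgebra structure $(\Delta,\varepsilon)$ on the vector space $A$, a linear form $\phi\in A^*$ and an element $t\in A$ such that, with $\Delta(c)=\sum c_1\otimes c_2$ and with the linear map $S:A\to A$ given by $S(b)=\sum\phi(t_1b)t_2$ (the antipode): (i) $\varepsilon$ is an algebra homomorphism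 and $\Delta(1)=1\otimes 1$; (ii) every element of $A^*$ is of the form $x\mapsto\phi(xb)$ with $b\in A$, and every element of $A$ is of the form $\sum f(t_1)t_2$ with $f\in A^*$; (iii) $S(1)=1$, $S(bc)=S(c)S(b)$, $\varepsilon(S(b))=\varepsilon(b)$ and $\Delta(S(b))=\sum S(b_2)\otimes S(b_1)$ for all $b,c\in A$. Then for every bi-Frobenius algebra structure on $A(\mathbf q,\mathbf a)$ whose antipode $S$ is a graded map (that is, $S$ maps each homogeneous component into itself), $S$ is a permutation antipode: there are a permutation $\pi$ of $V$ and scalars $c_{\mathbf v}\in\mathbb K$ such that $S(x_{\mathbf v})=c_{\mathbf v}x_{\pi(\mathbf v)}$ for all $\mathbf v\in V$. -/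

import Mathlib

open scoped TensorProduct

namespace BiFrob

section BiFrobenius

variable {K A : Type*} [Field K] [Ring A] [Algebra K A]

/-- The map `b ↦ (b ⇀ φ)` from `A` to `A* = Hom_K(A, K)`, where `(b ⇀ φ)(x) = φ(x b)`. -/
noncomputable def dualAct (φ : Module.Dual K A) : A →ₗ[K] Module.Dual K A :=
  (LinearMap.mul K A).flip.compr₂ φ

theorem dualAct_apply (φ : Module.Dual K A) (b x : A) : dualAct φ b x = φ (x * b) := rfl

/-- `(A, φ)` is a Frobenius algebra (`φ` is a Frobenius homomorphism): `A` is finite-dimensional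
and `A* = A ⇀ φ`. -/
structure IsFrobeniusAlgebra (φ : Module.Dual K A) : Prop where
  finiteDimensional : FiniteDimensional K A
  dualAct_surjective : Function.Surjective (dualAct φ)

section Coalg

variable {C : Type*} [AddCommGroup C] [Module K C] [Coalgebra K C]

/-- The map `f ↦ (t ↼ f)` from `C*` to `C`, where `t ↼ f = ∑ f(t₁) t₂` and `Δ(t) = ∑ t₁ ⊗ t₂`. -/
noncomputable def codualAct (t : C) : Module.Dual K C →ₗ[K] C :=
  (TensorProduct.lid K C).toLinearMap ∘ₗ
    (LinearMap.applyₗ (Coalgebra.comul (R := K) t)) ∘ₗ (LinearMap.rTensorHom C)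

theorem codualAct_apply (t : C) (f : Module.Dual K C) :
    codualAct t f = TensorProduct.lid K C (LinearMap.rTensor C f (Coalgebra.comul (R := K) t)) :=
  rfl

/-- `(C, t)` is a Frobenius coalgebra: `C` is finite-dimensional and `C = t ↼ C*`. -/
structure IsFrobeniusCoalgebra (K : Type*) [Field K] {C : Type*} [AddCommGroup C] [Module K C]
    [Coalgebra K C] (t : C) : Prop where
  finiteDimensional : FiniteDimensional K C
  codualAct_surjective : Function.Surjective (codualAct (K := K) t)

end Coalg

/-- `(A, φ, t, S)` is a bi-Frobenius algebra, where `A` is a finite-dimensional algebra and a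
coalgebra over the field `K`, `t ∈ A`, `φ ∈ A*`, and `S : A → A` is the linear map given by
`S(b) = ∑ φ(t₁ b) t₂`; then `S` is its antipode. No compatibility between the algebra and the
coalgebra structure is assumed beyond the listed conditions. -/
structure IsBiFrobenius [Coalgebra K A] (φ : Module.Dual K A) (t : A) (S : A →ₗ[K] A) : Prop where
  /-- `S(b) = t ↼ (b ⇀ φ) = ∑ φ(t₁ b) t₂`. -/
  antipode_eq : ∀ b : A, S b = codualAct t (dualAct φ b)
  /-- The counit is an algebra homomorphism. -/
  counit_one : Coalgebra.counit (R := K) (1 : A) = 1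
  counit_mul : ∀ x y : A, Coalgebra.counit (R := K) (x * y) =
    Coalgebra.counit (R := K) x * Coalgebra.counit (R := K) y
  /-- Together with `counit_one`: the identity is group-like. -/
  comul_one : Coalgebra.comul (R := K) (1 : A) = (1 : A) ⊗ₜ[K] (1 : A)
  frobeniusAlgebra : IsFrobeniusAlgebra φ
  frobeniusCoalgebra : IsFrobeniusCoalgebra K t
  /-- `S` is an algebra anti-homomorphism. -/
  antipode_one : S 1 = 1
  antipode_mul : ∀ x y : A, S (x * y) = S y * S x
  /-- `S` is a coalgebra anti-homomorphism: `ε ∘ S = ε` and `Δ(S(b)) = ∑ S(b₂) ⊗ S(b₁)`. -/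
  counit_antipode : ∀ b : A, Coalgebra.counit (R := K) (S b) = Coalgebra.counit (R := K) b
  comul_antipode : ∀ b : A, Coalgebra.comul (R := K) (S b) =
    TensorProduct.map S S (TensorProduct.comm K A A (Coalgebra.comul (R := K) b))

end BiFrobenius

section QuantumCompleteIntersection

variable {K : Type*} [Field K] {n : ℕ}

/-- The relations `x_i ^ a_i = 0` and `x_j x_i = q_ij x_i x_j` on the free algebra. -/
inductive QCIRel (q : Matrix (Fin n) (Fin n) K) (a : Fin n → ℕ) :
    FreeAlgebra K (Fin n) → FreeAlgebra K (Fin n) → Prop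
  | pow (i : Fin n) : QCIRel q a (FreeAlgebra.ι K i ^ a i) 0
  | comm (i j : Fin n) : QCIRel q a (FreeAlgebra.ι K j * FreeAlgebra.ι K i)
      (q i j • (FreeAlgebra.ι K i * FreeAlgebra.ι K j))

/-- The algebra `A(q, a) = K⟨x_1, …, x_n⟩ / ⟨x_i ^ a_i, x_j x_i - q_ij x_i x_j⟩`. -/
def QCI (q : Matrix (Fin n) (Fin n) K) (a : Fin n → ℕ) : Type _ := RingQuot (QCIRel q a)

variable (q : Matrix (Fin n) (Fin n) K) (a : Fin n → ℕ)

instance : Ring (QCI q a) := inferInstanceAs (Ring (RingQuot (QCIRel q a)))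

instance : Algebra K (QCI q a) := inferInstanceAs (Algebra K (RingQuot (QCIRel q a)))

/-- The generator `x_i` of `A(q, a)`. -/
def QCI.x (i : Fin n) : QCI q a := RingQuot.mkAlgHom K (QCIRel q a) (FreeAlgebra.ι K i)

/-- The index set `V` of the standard basis: exponent vectors `v` with `v_i < a_i` for all `i`. -/
abbrev QCI.Expo (a : Fin n → ℕ) : Type := (i : Fin n) → Fin (a i)

/-- The element `x_v = x_1 ^ v_1 ⋯ x_n ^ v_n` (factors in increasing order) of the standard
basis. -/
def QCI.mono (v : QCI.Expo a) : QCI q a :=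
  (List.ofFn fun i : Fin n => QCI.x q a i ^ (v i : ℕ)).prod

/-- The homogeneous component of degree `d`, spanned by the `x_v` with `v_1 + ⋯ + v_n = d`. -/
def QCI.homogeneous (d : ℕ) : Submodule K (QCI q a) :=
  Submodule.span K {y | ∃ v : QCI.Expo a, ∑ i, (v i : ℕ) = d ∧ y = QCI.mono q a v}

variable {q a}

/-- A linear map of `A(q, a)` is graded if it maps each homogeneous component into itself. -/
def QCI.IsGradedMap (S : QCI q a →ₗ[K] QCI q a) : Prop :=
  ∀ d : ℕ, ∀ y ∈ QCI.homogeneous q a d, S y ∈ QCI.homogeneous q a d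

/-- `S(x_v) = c_v x_{π(v)}` for a permutation `π` of `V` and scalars `c_v`. For the antipode `S` of
a bi-Frobenius structure on `A(q, a)` this says that `S` is a permutation antipode. -/
def QCI.IsPermutationAntipode (S : QCI q a →ₗ[K] QCI q a) : Prop :=
  ∃ (π : Equiv.Perm (QCI.Expo a)) (c : QCI.Expo a → K),
    ∀ v : QCI.Expo a, S (QCI.mono q a v) = c v • QCI.mono q a (π v)

end QuantumCompleteIntersection

end BiFrob

namespace BiFrob

/-! The coalgebra enters only through injectivity: `S` is a composite of two surjections, so it is
bijective in finite dimension. Being graded, it sends each `x_i` to a combination of generators with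
coefficients `s i k`. Apply `S` to `x_j x_i = q_ij x_i x_j` and compare coefficients of `x_k ^ 2`,
which is nonzero as `a_k ≥ 3`: `(1 - q_ij) s_ik s_jk = 0`. So each column of `s` has at most one
nonzero entry, while injectivity makes every row nonzero; hence `S` permutes the generators up to
scalars (`exists_perm_of_antimul`). Nilpotency orders must match (`exponent_perm_eq`), and
skew-commutation reorders the image of each monomial (`exists_smul_mono_of_antimul`). -/

/-- The antipode of a bi-Frobenius algebra is injective. -/
theorem IsBiFrobenius.antipode_injective {K A : Type*} [Field K] [Ring A] [Algebra K A]
    [Coalgebra K A] {φ : Module.Dual K A} {t : A} {S : A →ₗ[K] A} (h : IsBiFrobenius φ t S) :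
    Function.Injective S := by
  have := h.frobeniusAlgebra.finiteDimensional
  have hS : S = codualAct t ∘ₗ dualAct φ := LinearMap.ext h.antipode_eq
  rw [LinearMap.injective_iff_surjective, hS]
  exact h.frobeniusCoalgebra.codualAct_surjective.comp h.frobeniusAlgebra.dualAct_surjective

/-- An anti-multiplicative unital map sends powers to powers. -/
theorem map_pow_of_antimul {M : Type*} [Monoid M] {S : M → M} (h1 : S 1 = 1)
    (hmul : ∀ x y, S (x * y) = S y * S x) (x : M) (m : ℕ) : S (x ^ m) = S x ^ m := by
  induction m with
  | zero => simp [h1]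
  | succ m ih => rw [pow_succ, hmul, ih, pow_succ']

/-- An anti-multiplicative unital map reverses products of lists. -/
theorem map_list_prod_of_antimul {M : Type*} [Monoid M] {S : M → M} (h1 : S 1 = 1)
    (hmul : ∀ x y, S (x * y) = S y * S x) (l : List M) :
    S l.prod = (l.map S).reverse.prod := by
  induction l with
  | nil => simp [h1]
  | cons x l ih => simp [hmul, ih]

theorem prod_ofFn_eq_of_forall_ne {M : Type*} [Monoid M] {n : ℕ} (f : Fin n → M) (j : Fin n)
    (h : ∀ i, i ≠ j → f i = 1) : (List.ofFn f).prod = f j := by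
  induction n with
  | zero => exact j.elim0
  | succ n ih =>
    rw [List.ofFn_succ, List.prod_cons]
    rcases Fin.eq_zero_or_eq_succ j with rfl | ⟨k, rfl⟩
    · have : (fun i : Fin n => f i.succ) = fun _ => 1 :=
        funext fun i => h _ (Fin.succ_ne_zero i)
      rw [this]
      simp
    · rw [h 0 (Fin.succ_ne_zero k).symm, one_mul]
      exact ih (fun i => f i.succ) k fun i hi => h _ fun e => hi (Fin.succ_injective _ e)

/-! ### Reordering products of skew-commuting elements -/

section Skew

variable {K A : Type*} [CommSemiring K] [Semiring A] [Algebra K A]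

/-- `x` and `y` commute up to a scalar: `x * y = c • (y * x)` for some `c`. -/
def SkewCommute (K : Type*) {A : Type*} [CommSemiring K] [Semiring A] [Algebra K A]
    (x y : A) : Prop := ∃ c : K, x * y = c • (y * x)

theorem SkewCommute.pow_right {x y : A} (h : SkewCommute K x y) (m : ℕ) :
    SkewCommute K x (y ^ m) := by
  obtain ⟨c, hc⟩ := h
  refine ⟨c ^ m, ?_⟩
  induction m with
  | zero => simp
  | succ m ih =>
    rw [pow_succ, ← mul_assoc, ih, smul_mul_assoc, mul_assoc, hc, mul_smul_comm, smul_smul,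
      pow_succ, mul_assoc]

theorem SkewCommute.pow_left {x y : A} (h : SkewCommute K x y) (m : ℕ) :
    SkewCommute K (x ^ m) y := by
  obtain ⟨c, hc⟩ := h
  refine ⟨c ^ m, ?_⟩
  induction m with
  | zero => simp
  | succ m ih =>
    rw [pow_succ, mul_assoc, hc, mul_smul_comm, ← mul_assoc, ih, smul_mul_assoc, smul_smul,
      pow_succ, mul_assoc, mul_comm c]

/-- Products of pairwise skew-commuting elements taken in two orders agree up to a scalar. -/
theorem exists_smul_prod_of_perm {ι : Type*} {f : ι → A} (hf : ∀ i j, SkewCommute K (f i) (f j))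
    {l l' : List ι} (h : l.Perm l') : ∃ c : K, (l.map f).prod = c • (l'.map f).prod := by
  induction h with
  | nil => exact ⟨1, by simp⟩
  | cons x _ ih =>
    obtain ⟨c, hc⟩ := ih
    exact ⟨c, by simp [hc]⟩
  | swap x y l =>
    obtain ⟨c, hc⟩ := hf y x
    exact ⟨c, by simp [← mul_assoc, hc]⟩
  | trans _ _ ih₁ ih₂ =>
    obtain ⟨c, hc⟩ := ih₁
    obtain ⟨d, hd⟩ := ih₂
    exact ⟨c * d, by rw [hc, hd, smul_smul]⟩

/-- The product of scalar multiples of a family is a scalar multiple of its product. -/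
theorem exists_smul_prod_map {ι : Type*} {f g : ι → A} (h : ∀ i, ∃ c : K, g i = c • f i)
    (l : List ι) : ∃ c : K, (l.map g).prod = c • (l.map f).prod := by
  induction l with
  | nil => exact ⟨1, by simp⟩
  | cons i l ih =>
    obtain ⟨c, hc⟩ := ih
    obtain ⟨d, hd⟩ := h i
    exact ⟨c * d, by simp [hc, hd, smul_smul]⟩

end Skew

namespace QCI

variable {K : Type*} [Field K] {n : ℕ} {q : Matrix (Fin n) (Fin n) K} {a : Fin n → ℕ}

/-! ### Generators and their powers -/

theorem x_pow_eq_zero (i : Fin n) : x q a i ^ a i = 0 := by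
  have h := RingQuot.mkAlgHom_rel K (QCIRel.pow (q := q) (a := a) i)
  rw [map_pow, map_zero] at h
  exact h

theorem x_mul_x (i j : Fin n) : x q a j * x q a i = q i j • (x q a i * x q a j) := by
  have h := RingQuot.mkAlgHom_rel K (QCIRel.comm (q := q) (a := a) i j)
  rw [map_smul, map_mul, map_mul] at h
  exact h

/-- The projection of `A(q, a)` onto the truncated polynomial ring in `x_k`, which sends the
other generators to zero. -/
noncomputable def axisHom (hqdiag : ∀ i, q i i = 1) (ha : ∀ i, a i ≠ 0) (k : Fin n) :
    QCI q a →ₐ[K] AdjoinRoot (Polynomial.X ^ a k : Polynomial K) :=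
  RingQuot.liftAlgHom K (s := QCIRel q a)
    ⟨FreeAlgebra.lift K fun i => if i = k then AdjoinRoot.root _ else 0, by
      intro u v huv
      induction huv with
      | pow i =>
        by_cases hi : i = k
        · subst hi
          simp only [map_pow, FreeAlgebra.lift_ι_apply, if_true, map_zero]
          rw [← AdjoinRoot.mk_X, ← map_pow, AdjoinRoot.mk_self]
        · simp [hi, ha i]
      | comm i j =>
        by_cases hi : i = k
        · by_cases hj : j = k
          · subst hi hj
            -- The only commutation relation with both sides possibly nonzero; it needs `q_kk = 1`.
            simp [hqdiag]
          · simp [hj]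
        · simp [hi]⟩

theorem axisHom_x (hqdiag : ∀ i, q i i = 1) (ha : ∀ i, a i ≠ 0) (k i : Fin n) :
    axisHom hqdiag ha k (x q a i) = if i = k then AdjoinRoot.root _ else 0 := by
  unfold axisHom x
  erw [RingQuot.liftAlgHom_mkAlgHom_apply]
  simp

theorem root_pow_eq_zero_iff (d m : ℕ) :
    AdjoinRoot.root (Polynomial.X ^ d : Polynomial K) ^ m = 0 ↔ d ≤ m := by
  rw [← AdjoinRoot.mk_X, ← map_pow, AdjoinRoot.mk_eq_zero]
  exact pow_dvd_pow_iff Polynomial.X_ne_zero Polynomial.not_isUnit_X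

/-- Nonvanishing is detected in the truncated polynomial ring, so linear independence of the
standard basis is not needed. -/
theorem x_pow_eq_zero_iff (hqdiag : ∀ i, q i i = 1) (ha : ∀ i, a i ≠ 0) (i : Fin n) (m : ℕ) :
    x q a i ^ m = 0 ↔ a i ≤ m := by
  refine ⟨fun h => ?_, fun h => pow_eq_zero_of_le h (x_pow_eq_zero i)⟩
  have := congrArg (axisHom hqdiag ha i) h
  rwa [map_pow, map_zero, axisHom_x, if_pos rfl, root_pow_eq_zero_iff] at this

theorem axisHom_sum (hqdiag : ∀ i, q i i = 1) (ha : ∀ i, a i ≠ 0) (k : Fin n) (s : Fin n → K) :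
    axisHom hqdiag ha k (∑ i, s i • x q a i) = s k • AdjoinRoot.root _ := by
  simp [axisHom_x]

/-! ### The degree-one component -/

theorem mono_eq_x {v : Expo a} {j : Fin n} (hj : (v j : ℕ) = 1) (h : ∀ i, i ≠ j → (v i : ℕ) = 0) :
    mono q a v = x q a j := by
  unfold mono
  rw [prod_ofFn_eq_of_forall_ne _ j fun i hi => by rw [h i hi, pow_zero], hj, pow_one]

theorem x_mem_homogeneous_one (ha : ∀ i, 2 ≤ a i) (i : Fin n) : x q a i ∈ homogeneous q a 1 := by
  refine Submodule.subset_span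
    ⟨fun j => if j = i then ⟨1, ha j⟩ else ⟨0, zero_lt_two.trans_le (ha j)⟩, ?_, ?_⟩
  · rw [Finset.sum_eq_single i] <;> simp +contextual
  · exact (mono_eq_x (by simp) fun j hj => by simp [hj]).symm

theorem exists_eq_sum_of_mem_homogeneous_one {y : QCI q a} (hy : y ∈ homogeneous q a 1) :
    ∃ s : Fin n → K, y = ∑ i, s i • x q a i := by
  have hle : homogeneous q a 1 ≤ Submodule.span K (Set.range (x q a)) := by
    refine Submodule.span_le.2 ?_
    rintro _ ⟨v, hv, rfl⟩
    obtain ⟨j, -, hj⟩ : ∃ j ∈ Finset.univ, (v j : ℕ) ≠ 0 :=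
      Finset.exists_ne_zero_of_sum_ne_zero (by rw [hv]; exact one_ne_zero)
    have hsum := Finset.add_sum_erase Finset.univ (fun i => (v i : ℕ)) (Finset.mem_univ j)
    rw [hv] at hsum
    have hrest : ∑ i ∈ Finset.univ.erase j, (v i : ℕ) = 0 := by omega
    rw [mono_eq_x (j := j) (by omega) fun i hi =>
      Finset.sum_eq_zero_iff.1 hrest i (Finset.mem_erase.2 ⟨hi, Finset.mem_univ i⟩)]
    exact Submodule.subset_span ⟨j, rfl⟩
  obtain ⟨s, hs⟩ := (Submodule.mem_span_range_iff_exists_fun K).1 (hle hy)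
  exact ⟨s, hs.symm⟩

/-! ### The action of the antipode -/

/-- An injective graded anti-endomorphism permutes the generators up to scalars. -/
theorem exists_perm_of_antimul (hqdiag : ∀ i, q i i = 1) (ha : ∀ i, 3 ≤ a i)
    (hq : ∀ i j, i ≠ j → q i j ≠ 1) {S : QCI q a →ₗ[K] QCI q a} (hS : Function.Injective S)
    (hmul : ∀ x y, S (x * y) = S y * S x) (hgr : IsGradedMap S) :
    ∃ (σ : Equiv.Perm (Fin n)) (c : Fin n → K), ∀ i, S (x q a i) = c i • x q a (σ i) := by
  have ha0 : ∀ i, a i ≠ 0 := fun i => by have := ha i; omega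
  choose s hs using fun i => exists_eq_sum_of_mem_homogeneous_one
    (hgr 1 _ (x_mem_homogeneous_one (q := q) (fun j => (Nat.le_succ 2).trans (ha j)) i))
  -- Distinct rows of `s` have disjoint supports. The target of `axisHom` is commutative, so the
  -- reversal of factors by `S` is harmless there.
  have hdisj : ∀ k i j, i ≠ j → s i k * s j k = 0 := by
    intro k i j hij
    have h := congrArg (fun y => axisHom hqdiag ha0 k (S y)) (x_mul_x (q := q) (a := a) i j)
    simp only [map_smul, hmul, map_mul, hs, axisHom_sum] at h
    rw [smul_mul_smul_comm, smul_mul_smul_comm, smul_smul, ← sub_eq_zero, ← sub_smul, ← sq,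
      smul_eq_zero, root_pow_eq_zero_iff] at h
    have h' := h.resolve_right (by have := ha k; omega)
    have h2 : (1 - q i j) * (s i k * s j k) = 0 := by linear_combination h'
    exact (mul_eq_zero.1 h2).resolve_left (sub_ne_zero.2 (hq i j hij).symm)
  have hrow : ∀ i, ∃ k, s i k ≠ 0 := by
    intro i
    by_contra! h
    have h0 : x q a i = 0 := hS (by rw [hs i, map_zero]; simp [h])
    have := (x_pow_eq_zero_iff (q := q) hqdiag ha0 i 1).1 (by rw [h0, pow_one])
    have := ha i
    omega
  choose σ hσ using hrow
  have hinj : Function.Injective σ := by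
    intro i j hij
    by_contra hne
    refine mul_ne_zero (hσ i) ?_ (hdisj (σ i) i j hne)
    rw [hij]
    exact hσ j
  have hbij : Function.Bijective σ := Finite.injective_iff_bijective.1 hinj
  refine ⟨Equiv.ofBijective σ hbij, fun i => s i (σ i), fun i => ?_⟩
  rw [hs i, Finset.sum_eq_single (σ i)]
  · rfl
  · intro k _ hk
    obtain ⟨j, rfl⟩ := hbij.2 k
    have hij : i ≠ j := fun e => hk (by rw [e])
    rw [(mul_eq_zero.1 (hdisj (σ j) i j hij)).resolve_right (hσ j), zero_smul]
  · simp

theorem skewCommute_x (i j : Fin n) : SkewCommute K (x q a i) (x q a j) :=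
  ⟨q j i, x_mul_x j i⟩

/-- An injective unital anti-endomorphism that permutes the generators up to scalars preserves
the exponents `a_i`. -/
theorem exponent_perm_eq (hqdiag : ∀ i, q i i = 1) (ha : ∀ i, 2 ≤ a i)
    {S : QCI q a →ₗ[K] QCI q a} (hS : Function.Injective S) (h1 : S 1 = 1)
    (hmul : ∀ x y, S (x * y) = S y * S x) {σ : Equiv.Perm (Fin n)} {c : Fin n → K}
    (h : ∀ i, S (x q a i) = c i • x q a (σ i)) (i : Fin n) : a (σ i) = a i := by
  have ha0 : ∀ i, a i ≠ 0 := fun i => by have := ha i; omega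
  have hpow : ∀ m, S (x q a i ^ m) = c i ^ m • x q a (σ i) ^ m := fun m => by
    rw [map_pow_of_antimul h1 hmul, h, smul_pow]
  have hzero : ∀ m, x q a i ^ m = 0 ↔ c i ^ m • x q a (σ i) ^ m = 0 := fun m => by
    rw [← hpow, map_eq_zero_iff S hS]
  apply le_antisymm
  · refine (x_pow_eq_zero_iff (q := q) hqdiag ha0 (σ i) (a i)).1 ?_
    -- If `c i` vanished, `S` would kill the nonzero element `x_i`.
    refine (smul_eq_zero.1 ((hzero (a i)).1 (x_pow_eq_zero i))).resolve_left fun hc => ?_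
    have hx : x q a i = 0 := hS (by rw [h, eq_zero_of_pow_eq_zero hc, zero_smul, map_zero])
    exact absurd ((x_pow_eq_zero_iff (q := q) hqdiag ha0 i 1).1 (by rw [hx, pow_one]))
      (not_le.2 (ha i))
  · exact (x_pow_eq_zero_iff (q := q) hqdiag ha0 i (a (σ i))).1
      ((hzero _).2 (by rw [x_pow_eq_zero, smul_zero]))

/-- The permutation `v ↦ v ∘ σ⁻¹` of the exponent vectors. -/
noncomputable def expoPerm (σ : Equiv.Perm (Fin n)) (h : ∀ i, a (σ i) = a i) :
    Equiv.Perm (Expo a) :=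
  Equiv.ofBijective
    (fun v j => Fin.cast (by rw [← h, σ.apply_symm_apply]) (v (σ.symm j)))
    (Finite.injective_iff_bijective.1 fun v w hvw => funext fun i => by
      have := congrArg Fin.val (congrFun hvw (σ i))
      simp only [Fin.val_cast] at this
      rw [σ.symm_apply_apply] at this
      exact Fin.ext this)

theorem expoPerm_apply (σ : Equiv.Perm (Fin n)) (h : ∀ i, a (σ i) = a i) (v : Expo a)
    (j : Fin n) : (expoPerm σ h v j : ℕ) = v (σ.symm j) := rfl

/-- A unital anti-endomorphism that permutes the generators up to scalars permutes the standard
basis up to scalars. -/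
theorem exists_smul_mono_of_antimul {S : QCI q a →ₗ[K] QCI q a} (h1 : S 1 = 1)
    (hmul : ∀ x y, S (x * y) = S y * S x) {σ : Equiv.Perm (Fin n)} {c : Fin n → K}
    (h : ∀ i, S (x q a i) = c i • x q a (σ i)) (hσ : ∀ i, a (σ i) = a i) (v : Expo a) :
    ∃ d : K, S (mono q a v) = d • mono q a (expoPerm σ hσ v) := by
  let g : Fin n → QCI q a := fun j => x q a j ^ (expoPerm σ hσ v j : ℕ)
  have hg : ∀ i j, SkewCommute K (g i) (g j) := fun i j =>
    ((skewCommute_x i j).pow_left _).pow_right _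
  have hgen : ∀ i, ∃ d : K, S (x q a i ^ (v i : ℕ)) = d • g (σ i) := fun i =>
    ⟨c i ^ (v i : ℕ), by
      simp only [g, expoPerm_apply]
      rw [σ.symm_apply_apply, map_pow_of_antimul h1 hmul, h, smul_pow]⟩
  -- `S` reverses the factors and relabels them by `σ`; the resulting index list still runs once
  -- through `Fin n`.
  have hperm : ((List.finRange n).reverse.map σ).Perm (List.finRange n) := by
    refine (List.perm_ext_iff_of_nodup ?_ (List.nodup_finRange n)).2 fun j => ?_
    · exact (List.nodup_reverse.2 (List.nodup_finRange n)).map σ.injective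
    · simpa using σ.surjective j
  obtain ⟨d, hd⟩ := exists_smul_prod_map hgen (List.finRange n).reverse
  obtain ⟨e, he⟩ := exists_smul_prod_of_perm hg hperm
  refine ⟨d * e, ?_⟩
  unfold mono
  rw [List.ofFn_eq_map, List.ofFn_eq_map, map_list_prod_of_antimul h1 hmul, List.map_map,
    ← List.map_reverse]
  refine hd.trans ?_
  rw [mul_smul, ← he, List.map_map]
  rfl

end QCI

end BiFrob

theorem proposition5p5 {K : Type*} [Field K] {n : ℕ} (hn : 2 ≤ n)
    (q : Matrix (Fin n) (Fin n) K) (a : Fin n → ℕ)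
    (hqdiag : ∀ i, q i i = 1) (hqinv : ∀ i j, q i j * q j i = 1)
    (ha : ∀ i, 3 ≤ a i) (hq : ∀ i j, i ≠ j → q i j ≠ 1)
    [Coalgebra K (BiFrob.QCI q a)]
    (φ : Module.Dual K (BiFrob.QCI q a)) (t : BiFrob.QCI q a)
    (S : BiFrob.QCI q a →ₗ[K] BiFrob.QCI q a)
    (hbF : BiFrob.IsBiFrobenius φ t S)
    (hgr : BiFrob.QCI.IsGradedMap S) :
    BiFrob.QCI.IsPermutationAntipode S := by
  obtain ⟨σ, c, hσ⟩ := BiFrob.QCI.exists_perm_of_antimul hqdiag ha hq hbF.antipode_injective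
    hbF.antipode_mul hgr
  have haσ : ∀ i, a (σ i) = a i := BiFrob.QCI.exponent_perm_eq hqdiag
    (fun i => (Nat.le_succ 2).trans (ha i)) hbF.antipode_injective hbF.antipode_one
    hbF.antipode_mul hσ
  choose d hd using BiFrob.QCI.exists_smul_mono_of_antimul hbF.antipode_one hbF.antipode_mul hσ haσ
  exact ⟨BiFrob.QCI.expoPerm σ haσ, d, hd⟩
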